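/- **Setting.** Let $\mathrm{Rot}\,\mathbb E^2=\mathbb C\times U(1)$ be the quandle with $(z,e^{\theta\sqrt{-1}})*(w,e^{\eta\sqrt{-1}})=((z-w)e^{\eta\sqrt{-1}}+w,\,e^{\theta\sqrt{-1}})$. Let $p,q$ be coprime integers with $|p|,|q|\ge 2$, and let $D(p,q)$ be the standard diagram of the $(p,q)$-torus knot. Its arcs carry labels $a_{ij}$ ($i\in\mathbb Z/|q|$, $j\in\mathbb Z/|p|$), where $a_{i,0}$ and $a_{i+1,|p|-1}$ mark the same arc. For each $i$ and each $1\le j\le |p|-1$ there is one crossing, at which $a_{i,0}$ passes over and the under arcs are $a_{i,j}$ and $a_{i+1,j-1}$. A coloring of $D(p,q)$ is a map $\mathscr C$ from the set of arcs to $\mathrm{Rot}\,\mathbb E^2$ with $\mathscr C(a_{i+1,j-1})=\mathscr C(a_{i,j})*\mathscr C(a_{i,0})$ at every crossing. A *shift* (a planar isotopy turning the diagram by one block) replaces $\mathscr C$ by the coloring $a_{ij}\mapsto\mathscr C(a_{i+1,j})$ of $D(p,q)$. A *switch* (the deformation $D(p,q)\to D(q,p)$ exchanging the two directions of the torus on which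 the knot lies) replaces $\mathscr C$ by the coloring $\mathscr C'$ of $D(q,p)$ such that, with $b_{ij}$ ($i\in\mathbb Z/|p|$, $j\in\mathbb Z/|q|$) denoting the labels of the arcs of $D(q,p)$, one has $\mathscr C'(b_{0,j})=\mathscr C(a_{-j,|p|-1})$ for all $j$ and $\mathscr C'(b_{i,|q|-1})=\mathscr C(a_{0,-i})$ for all $i$. There is at most one such coloring. A regular polygon of type $(m,k)$ ($m\ge2$, $1\le k\le m-1$) is a list of points $(u_{0},u_{k},u_{2k},\dots,u_{(m-1)k})$, indices modulo $m$, where $u_0,\dots,u_{m-1}$ are the vertices of a convex regular $m$-gon in counterclockwise order (a segment if $m=2$). Let $1\le k\le|p|-1$ and $1\le l\le|q|-1$. Let $Q=(v_0,\dots,v_{|q|-1})$ be a regular polygon of type $(|q|,l)$ and $P_0=(w_{00},\dots,w_{0,|p|-1})$ one of type $(|p|,k)$, with $w_{00}=v_0$, $w_{01}=v_1$, and side length $|v_1-v_0|=1$. Put $\theta=\left(\frac{|p|-2k}{|p|}-\frac{|q|-2l}{|q|}\right)\pi$, and for $i\ge 1$ let $P_i=(w_{i0},\dots,w_{i,|p|-1})$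 be obtained from $P_{i-1}$ by the rotation by $\theta$ about $v_i$ (index of $v$ modulo $|q|$). Let $\mathscr C_0$ be the coloring $\mathscr C_0(a_{ij})=(w_{i,i+j+1},e^{\theta\sqrt{-1}})$ of $D(p,q)$, where $0\le i\le |q|-1$ and the second index of $w$ is read modulo $|p|$. Let $p'=|p|/\gcd(|p|,k)$ and $q'=|q|/\gcd(|q|,l)$. Let $\alpha=p'q'/2$ if $p'q'$ is even and $\alpha=p'q'$ otherwise. For $0\le\sigma\le 2\alpha-1$ let $v_\sigma$ be the unit complex number at the angle $\arg(w_{01}-w_{00})+\sigma\pi/\alpha$ (these are not the vertices of $Q$). Let $\mathscr W_1\subset\mathbb C$ be the smallest set that contains $w_{00}$ and contains $w+v_\sigma$ whenever it contains $w$, for every $0\le\sigma\le2\alpha-1$. **Proposition 6.1.** Let $\mathscr W_2$ be the set of all points of $\mathbb C$ that occur as the first component of the color of an arc of $D(p,q)$ in some coloring obtained from $\mathscr C_0$ by a finite sequence of shifts and switches with an even number of switches. Then $$\mathscr W_1=\mathscr W_2=\Bigl\{\,w_{00}+\sum_{0\le\sigma\le 2\alpha-1}a_\sigma v_\sigma \;\Big|\;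 a_\sigma\in\mathbb Z\Bigr\}.$$ -/

import Mathlib

noncomputable section

/-! ### The quandle of rotations of the Euclidean plane -/

/-- An element of `Rot 𝔼² = ℂ × U(1)`: the rotation about `center` by the angle `rot`. -/
@[ext]
structure RotE2 where
  center : ℂ
  rot : Circle

/-- The quandle structure of `Rot 𝔼²`. Mathlib writes `y ◃ x` for the element `x ∗ y`; thus
`(z, e^{iθ}) ∗ (w, e^{iη}) = ((z - w) e^{iη} + w, e^{iθ})` and
`(z, e^{iθ}) ∗⁻¹ (w, e^{iη}) = ((z - w) e^{-iη} + w, e^{iθ})`. -/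
instance RotE2.instQuandle : Quandle RotE2 where
  act y x := ⟨(x.center - y.center) * (y.rot : ℂ) + y.center, x.rot⟩
  self_distrib := by
    intro x y z
    ext
    · simp only; ring
    · rfl
  invAct y x := ⟨(x.center - y.center) * ((y.rot⁻¹ : Circle) : ℂ) + y.center, x.rot⟩
  left_inv := by
    intro y x
    ext
    · simp
    · rfl
  right_inv := by
    intro y x
    ext
    · simp
    · rfl
  fix := by
    intro x
    ext
    · simp
    · rfl

/-! ### The diagram `D(p, q)` and its colorings -/

/-- The labels `a_{ij}` (`0 ≤ i ≤ |q| - 1`, `0 ≤ j ≤ |p| - 1`) on the arcs of `D(p, q)`, the first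
index being read modulo `|q|` and the second one modulo `|p|`. -/
abbrev ArcLabel (p q : ℤ) : Type := ZMod q.natAbs × ZMod p.natAbs

/-- The labels `a_{i,0}` and `a_{i+1,|p|-1}` mark the same arc. -/
inductive SameArc (p q : ℤ) : ArcLabel p q → ArcLabel p q → Prop
  | glue (i : ZMod q.natAbs) : SameArc p q (i, 0) (i + 1, -1)

/-- The set of arcs of the standard diagram `D(p, q)` of the `(p, q)`-torus knot
(the closed braid on `|p|` strands with `|q|` blocks, where in each block one strand
passes over the `|p| - 1` others). -/
def TorusArc (p q : ℤ) : Type := Quot (SameArc p q)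

/-- The arc of `D(p, q)` with the label `a_{ij}`. -/
def TorusArc.mk {p q : ℤ} (i : ZMod q.natAbs) (j : ZMod p.natAbs) : TorusArc p q :=
  Quot.mk _ (i, j)

/-- An `X`-coloring of `D(p, q)`: a map from the set of arcs to the quandle `X` that satisfies the
coloring condition at each crossing. For each `i`, the arc `a_{i,0} = a_{i+1,|p|-1}` passes over
`|p| - 1` crossings; at the `j`-th one (`1 ≤ j ≤ |p| - 1`) the under arcs are
`a_{i,j}` and `a_{i+1,j-1}`, and the condition is
`C(a_{i+1,j-1}) = C(a_{i,j}) ∗ C(a_{i,0})`. With this labelling the condition reads the same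
for `pq > 0` and for `pq < 0`. -/
@[ext]
structure TorusColoring (X : Type*) [Quandle X] (p q : ℤ) where
  color : TorusArc p q → X
  crossing : ∀ (i : ZMod q.natAbs) (j : ZMod p.natAbs), j ≠ 0 →
    color (.mk (i + 1) (j - 1)) = Shelf.act (color (.mk i 0)) (color (.mk i j))

/-! ### Shifts and switches -/

/-- The correspondence of arcs under a shift, the planar isotopy which turns the closed diagram by
one block: the new arc `a_{ij}` is the old arc `a_{i+1,j}`. -/
def TorusArc.shift {p q : ℤ} : TorusArc p q → TorusArc p q :=
  Quot.map (fun a => (a.1 + 1, a.2)) (by rintro _ _ ⟨i⟩; exact SameArc.glue (i + 1))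

/-- The coloring of `D(p, q)` obtained from `C` by a shift. -/
def TorusColoring.shift {X : Type*} [Quandle X] {p q : ℤ} (C : TorusColoring X p q) :
    TorusColoring X p q where
  color a := C.color a.shift
  crossing i j hj := C.crossing (i + 1) j hj

/-- The coloring `C'` of `D(q, p)` is obtained from the coloring `C` of `D(p, q)` by a switch, the
deformation which exchanges the two directions of the torus on which the knot lies. The arcs over
which nothing passes during the deformation keep their colors: writing `a_{ij}` for the arcs of
`D(p, q)` and `b_{ij}` for those of `D(q, p)`, these arcs are
`b_{0,j} = a_{-j,|p|-1}` and `b_{i,|q|-1} = a_{0,-i}`. The colors of all other arcs of `D(q, p)`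
are then forced by the coloring condition. -/
def TorusColoring.IsSwitch {X : Type*} [Quandle X] {p q : ℤ}
    (C : TorusColoring X p q) (C' : TorusColoring X q p) : Prop :=
  (∀ j : ZMod q.natAbs, C'.color (.mk 0 j) = C.color (.mk (-j) (-1))) ∧
  (∀ i : ZMod p.natAbs, C'.color (.mk i (-1)) = C.color (.mk 0 (-i)))

/-- `Obtained C₀ s C`: the coloring `C` (of `D(p, q)` or of `D(q, p)`) is obtained from the
coloring `C₀` of `D(p, q)` by a finite sequence of shifts and switches, exactly `s` of
which are switches. -/
inductive TorusColoring.Obtained {X : Type*} [Quandle X] {p q : ℤ} (C₀ : TorusColoring X p q) :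
    ℕ → ∀ {p₁ q₁ : ℤ}, TorusColoring X p₁ q₁ → Prop
  | refl : Obtained C₀ 0 C₀
  | shift {s : ℕ} {p₁ q₁ : ℤ} {C : TorusColoring X p₁ q₁} :
      Obtained C₀ s C → Obtained C₀ s C.shift
  | switch {s : ℕ} {p₁ q₁ : ℤ} {C : TorusColoring X p₁ q₁} {C' : TorusColoring X q₁ p₁} :
      Obtained C₀ s C → C.IsSwitch C' → Obtained C₀ (s + 1) C'

/-- The points of `ℂ` which some coloring of `D(p, q)`, obtained from `C₀` by shifts and an even
number of switches, uses as the first component of the color of an arc. -/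
def TorusColoring.reachedPoints {p q : ℤ} (C₀ : TorusColoring RotE2 p q) : Set ℂ :=
  {z | ∃ (s : ℕ) (C : TorusColoring RotE2 p q) (a : TorusArc p q),
    Even s ∧ C₀.Obtained s C ∧ (C.color a).center = z}

/-! ### Regular polygons and trochoids -/

/-- `u` lists the vertices of a convex regular `m`-gon in counterclockwise order. -/
def IsConvexRegularPolygon (m : ℕ) (u : ZMod m → ℂ) : Prop :=
  ∃ c r : ℂ, r ≠ 0 ∧ ∀ i, u i = c + r * Complex.exp (2 * Real.pi * Complex.I * i.val / m)

/-- `v` lists the vertices of a regular polygon of type `(m, k)`: `v i` is the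
vertex number `ik` (modulo `m`) of a convex regular `m`-gon. -/
def IsRegularPolygon (m k : ℕ) (v : ZMod m → ℂ) : Prop :=
  ∃ u : ZMod m → ℂ, IsConvexRegularPolygon m u ∧ ∀ i, v i = u (i * k)

/-- The data of an `(m, k; n, l)`-trochoid around `Q` starting at `P₀`: a regular polygon `Q` of
type `(n, l)` and a regular polygon `P₀` of type `(m, k)` which share their first edge. -/
structure Trochoid (m k n l : ℕ) where
  two_le_m : 2 ≤ m
  two_le_n : 2 ≤ n
  one_le_k : 1 ≤ k
  k_lt : k < m
  one_le_l : 1 ≤ l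
  l_lt : l < n
  /-- the vertices `v₀, …, v_{n-1}` of `Q` -/
  Q : ZMod n → ℂ
  /-- the vertices `w₀₀, …, w_{0,m-1}` of `P₀` -/
  P₀ : ZMod m → ℂ
  regular_Q : IsRegularPolygon n l Q
  regular_P₀ : IsRegularPolygon m k P₀
  vertex_zero : P₀ 0 = Q 0
  vertex_one : P₀ 1 = Q 1

namespace Trochoid

variable {m k n l : ℕ}

/-- The angle `θ(m, k; n, l)`. -/
def angle (_T : Trochoid m k n l) : ℝ :=
  (((m : ℝ) - 2 * k) / m - ((n : ℝ) - 2 * l) / n) * Real.pi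

/-- The vertices `w_{ij}` of `P_i`: the polygon `P_{i+1}` is obtained from `P_i` by the rotation by
the angle `θ` about the vertex `v_{i+1}` of `Q`. -/
def w (T : Trochoid m k n l) : ℕ → ZMod m → ℂ
  | 0, j => T.P₀ j
  | i + 1, j => (T.w i j - T.Q (i + 1 : ℕ)) * (Circle.exp T.angle : ℂ) + T.Q (i + 1 : ℕ)

end Trochoid

theorem IsRegularPolygon.exists_center {m k : ℕ} (hm : 2 ≤ m) {v : ZMod m → ℂ}
    (h : IsRegularPolygon m k v) : ∃ c : ℂ, ∀ i,
      v (i + 1) - c = Complex.exp (2 * Real.pi * Complex.I * k / m) * (v i - c) := by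
  obtain ⟨u, ⟨c, r, -, hu⟩, hv⟩ := h
  have : NeZero m := ⟨by omega⟩
  have key : ∀ x : ZMod m, u x = c + r * (ZMod.toCircle x : ℂ) := by
    intro x
    rw [hu, ZMod.toCircle_apply]
  have hk : (ZMod.toCircle (k : ZMod m) : ℂ) =
      Complex.exp (2 * Real.pi * Complex.I * k / m) := by
    have := ZMod.toCircle_intCast (N := m) (k : ℤ)
    simpa using this
  refine ⟨c, fun i => ?_⟩
  rw [hv, hv, key, key, add_mul, one_mul, AddChar.map_add_eq_mul, Circle.coe_mul, hk]
  ring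

namespace Trochoid

variable {m k n l : ℕ}

theorem w_formula (T : Trochoid m k n l) (i : ℕ) (j : ZMod m) :
    T.Q (i + 1) - T.Q i =
        Complex.exp (2 * Real.pi * Complex.I * l / n) ^ i * (T.P₀ 1 - T.P₀ 0) ∧
    (T.P₀ (j + 1) - T.P₀ 1) * (Circle.exp T.angle : ℂ) =
        Complex.exp (2 * Real.pi * Complex.I * l / n) * (T.P₀ j - T.P₀ 0) ∧
    T.w i (i + j) =
        T.Q i + Complex.exp (2 * Real.pi * Complex.I * l / n) ^ i * (T.P₀ j - T.P₀ 0) := by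
  obtain ⟨cQ, hQ⟩ := T.regular_Q.exists_center T.two_le_n
  obtain ⟨cP, hP⟩ := T.regular_P₀.exists_center T.two_le_m
  have hm : (m : ℂ) ≠ 0 := by have := T.two_le_m; exact_mod_cast (by omega : m ≠ 0)
  have hn : (n : ℂ) ≠ 0 := by have := T.two_le_n; exact_mod_cast (by omega : n ≠ 0)
  have hexp : Complex.exp (2 * Real.pi * Complex.I * k / m) * (Circle.exp T.angle : ℂ) =
      Complex.exp (2 * Real.pi * Complex.I * l / n) := by
    rw [Circle.coe_exp, ← Complex.exp_add]
    congr 1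
    simp only [angle]
    push_cast
    field_simp
    ring
  set η := Complex.exp (2 * Real.pi * Complex.I * l / n) with hη
  have h1 : ∀ i : ℕ, T.Q (i + 1) - T.Q i = η ^ i * (T.P₀ 1 - T.P₀ 0) := by
    intro i
    induction i with
    | zero => simp [T.vertex_zero, T.vertex_one]
    | succ i ih =>
      have e1 := hQ ((i : ZMod n) + 1)
      have e2 := hQ (i : ZMod n)
      push_cast
      rw [pow_succ]
      linear_combination η * ih + e1 - e2
  have h2 : ∀ j : ZMod m, (T.P₀ (j + 1) - T.P₀ 1) * (Circle.exp T.angle : ℂ) =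
      η * (T.P₀ j - T.P₀ 0) := by
    intro j
    have e1 := hP j
    have e2 := hP 0
    rw [zero_add] at e2
    rw [← hexp]
    linear_combination (Circle.exp T.angle : ℂ) * (e1 - e2)
  refine ⟨h1 i, h2 j, ?_⟩
  induction i generalizing j with
  | zero => simp [w, T.vertex_zero]
  | succ i ih =>
    have e := ih (j + 1)
    have e1 := h1 i
    have e2 := h2 j
    have hidx : ((i + 1 : ℕ) : ZMod m) + j = (i : ZMod m) + (j + 1) := by push_cast; ring
    rw [hidx, w, e, pow_succ]
    simp only [Nat.cast_add, Nat.cast_one]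
    linear_combination η ^ i * e2 - (Circle.exp T.angle : ℂ) * e1

theorem w_val (T : Trochoid m k n l) (i : ZMod n) (j : ZMod m) :
    T.w i.val (i.val + j) =
      T.Q i + Complex.exp (2 * Real.pi * Complex.I * l / n) ^ i.val * (T.P₀ j - T.P₀ 0) := by
  have : NeZero n := ⟨by have := T.two_le_n; omega⟩
  simpa using (T.w_formula i.val j).2.2

theorem Q_val (T : Trochoid m k n l) (i : ZMod n) :
    T.Q (i + 1) - T.Q i =
      Complex.exp (2 * Real.pi * Complex.I * l / n) ^ i.val * (T.P₀ 1 - T.P₀ 0) := by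
  have : NeZero n := ⟨by have := T.two_le_n; omega⟩
  simpa using (T.w_formula i.val 0).1

theorem pow_val_succ (T : Trochoid m k n l) (i : ZMod n) :
    Complex.exp (2 * Real.pi * Complex.I * l / n) ^ (i + 1).val =
      Complex.exp (2 * Real.pi * Complex.I * l / n) ^ i.val *
        Complex.exp (2 * Real.pi * Complex.I * l / n) := by
  have h2 := T.two_le_n
  have : NeZero n := ⟨by omega⟩
  have : Fact (1 < n) := ⟨by omega⟩
  have hn : (n : ℂ) ≠ 0 := by exact_mod_cast (by omega : n ≠ 0)
  have h1 : Complex.exp (2 * Real.pi * Complex.I * l / n) ^ n = 1 := by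
    rw [← Complex.exp_nat_mul, Complex.exp_eq_one_iff]
    exact ⟨l, by push_cast; field_simp⟩
  rw [ZMod.val_add, ZMod.val_one, ← pow_eq_pow_mod _ h1, pow_succ]

/-- The coloring `C(Q, P₀)` of `D(p, q)` derived from the `(|p|, k; |q|, l)`-trochoid around `Q`
starting at `P₀`: the arc `a_{ij}` gets the color `(w_{i,i+j+1}, e^{iθ})`. -/
def coloring {p q : ℤ} {k l : ℕ} (T : Trochoid p.natAbs k q.natAbs l) :
    TorusColoring RotE2 p q where
  color := Quot.lift (fun a => ⟨T.w a.1.val (a.1.val + a.2 + 1), Circle.exp T.angle⟩) (by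
    rintro _ _ ⟨i⟩
    have e1 := T.w_val i 1
    have e2 := T.w_val (i + 1) 0
    have e3 := T.Q_val i
    ext
    · simp only [add_zero, neg_add_cancel_right] at e1 e2 ⊢
      rw [e1, e2]
      linear_combination -e3
    · rfl)
  crossing := by
    intro i j _
    have e1 := T.w_val (i + 1) j
    have e2 := T.w_val i (j + 1)
    have e3 := T.w_val i 1
    have e4 := T.Q_val i
    have e5 := T.pow_val_succ i
    have e6 := (T.w_formula 0 j).2.1
    ext
    · simp only [TorusArc.mk, Shelf.act, add_zero]
      rw [add_assoc, sub_add_cancel, add_assoc, e1, e2, e3, e5]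
      linear_combination e4 - Complex.exp (2 * Real.pi * Complex.I * l / q.natAbs) ^ i.val * e6
    · rfl

end Trochoid

/-! ### The lattice-like set -/

/-- The integer `α`: half of `p'q'` if `p'q'` is even, and `p'q'` otherwise, where
`p' = |p| / gcd(|p|, k)` and `q' = |q| / gcd(|q|, l)`. -/
def trochoidAlpha (p q : ℤ) (k l : ℕ) : ℕ :=
  let p' := p.natAbs / Nat.gcd p.natAbs k
  let q' := q.natAbs / Nat.gcd q.natAbs l
  if Even (p' * q') then p' * q' / 2 else p' * q'

/-- The unit vector `v_σ` at the angle `arg d + σπ/α`. -/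
def unitVector (α : ℕ) (d : ℂ) (σ : ℕ) : ℂ :=
  Real.cos (Complex.arg d + σ * Real.pi / α) + Real.sin (Complex.arg d + σ * Real.pi / α) * Complex.I

/-- The inductively constructed set: it contains `w₀`, and with `x` it contains
`x + v_σ` for all `0 ≤ σ ≤ 2α - 1`. -/
inductive GeneratedSet (α : ℕ) (w₀ d : ℂ) : Set ℂ
  | base : GeneratedSet α w₀ d w₀
  | step (x : ℂ) (σ : ℕ) : GeneratedSet α w₀ d x → σ < 2 * α →
      GeneratedSet α w₀ d (x + unitVector α d σ)

end

/-!
Put `η = exp (2πil/|q|)` and `μ = exp (2πik/|p|)`, the factors by which the edges of `Q` and `P₀`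
turn, and let `e` be the first edge of both polygons, a unit complex number. The unit vectors
`v_σ` are `e` times the powers of a primitive root of unity of order `2α`. As the orders of `η`
and `μ` are coprime, this root generates the ring `ℤ[η, μ]`
(`adjoin_pair_eq_adjoin_singleton`), so that the integral combinations of the `v_σ` are the
elements of `e ℤ[η, μ]`. Negative coefficients are not needed, as `-v_σ` is again one of these
vectors (`generatedSet_of_mem_adjoin`).

The coloring of a trochoid is determined by its frame `(w, e)`: the first vertex and the first
edge (`frameColoring`). A shift acts on frames by `(w, e) ↦ (w + e, e η)`, and a suitable number
of shifts between two switches acts by `(w, e) ↦ (w + e, e μ)`. The commutator of these two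
motions yields the translation by `e (η - μ)`, and conjugation by the motions shows that the `g`
for which translation by `e g` can be realized form an ideal of `ℤ[η, μ]`. Since `|p|` and `|q|`
are coprime, `η - μ` is a unit of this ring (`isUnit_sub_of_coprime_geom_sum`), so all
translations by elements of `e ℤ[η, μ]` occur (`translate_mem_of_stable`). Conversely, the colors
with center in `w₀₀ + e ℤ[η, μ]` and rotation `η μ⁻¹` are closed under the quandle operation, so
that no other point is reached (`TorusColoring.Obtained.color_mem`).
-/

open Complex

/-! ### Colorings attached to a frame -/

/-- The coloring of `D(p, q)` all of whose colors have rotation `ρ` and in which `a_{ij}` has the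
center `w + e ([i]_η + η ^ i [j + 1]_μ)`, where `η = ψ 1`, `μ = χ 1` and
`[t]_x = 1 + x + ⋯ + x ^ (t - 1)`. The geometric sums are written as quotients, with the powers
replaced by additive characters, so that they make sense for indices in `ZMod`. -/
noncomputable def frameColoring {p q : ℤ} (χ : AddChar (ZMod p.natAbs) ℂ)
    (ψ : AddChar (ZMod q.natAbs) ℂ) (ρ : Circle) (hχ : χ 1 ≠ 1) (hψ : ψ 1 ≠ 1)
    (hρ : ρ * χ 1 = ψ 1) (w e : ℂ) : TorusColoring RotE2 p q where
  color := Quot.lift (fun a => ⟨w + e * ((1 - ψ a.1) / (1 - ψ 1) +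
      ψ a.1 * ((1 - χ (a.2 + 1)) / (1 - χ 1))), ρ⟩) (by
    rintro _ _ ⟨i⟩
    have h1 : 1 - χ 1 ≠ 0 := sub_ne_zero.2 hχ.symm
    have h2 : 1 - ψ 1 ≠ 0 := sub_ne_zero.2 hψ.symm
    ext
    · simp only [zero_add, neg_add_cancel, AddChar.map_zero_eq_one, AddChar.map_add_eq_mul]
      field_simp
      ring
    · rfl)
  crossing := by
    intro i j _
    have h1 : 1 - χ 1 ≠ 0 := sub_ne_zero.2 hχ.symm
    have h2 : 1 - ψ 1 ≠ 0 := sub_ne_zero.2 hψ.symm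
    ext
    · change w + e * ((1 - ψ (i + 1)) / (1 - ψ 1) +
          ψ (i + 1) * ((1 - χ (j - 1 + 1)) / (1 - χ 1))) =
        (w + e * ((1 - ψ i) / (1 - ψ 1) + ψ i * ((1 - χ (j + 1)) / (1 - χ 1))) -
          (w + e * ((1 - ψ i) / (1 - ψ 1) + ψ i * ((1 - χ (0 + 1)) / (1 - χ 1))))) * (ρ : ℂ) +
        (w + e * ((1 - ψ i) / (1 - ψ 1) + ψ i * ((1 - χ (0 + 1)) / (1 - χ 1))))
      simp only [zero_add, sub_add_cancel, AddChar.map_add_eq_mul]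
      field_simp
      linear_combination (1 - ψ 1) * e * ψ i * (χ j - 1) * hρ
    · rfl

section Frame

variable {p q : ℤ} {χ : AddChar (ZMod p.natAbs) ℂ} {ψ : AddChar (ZMod q.natAbs) ℂ}
  {ρ : Circle} {hχ : χ 1 ≠ 1} {hψ : ψ 1 ≠ 1} {hρ : ρ * χ 1 = ψ 1}

theorem frameColoring_color (w e : ℂ) (i : ZMod q.natAbs) (j : ZMod p.natAbs) :
    (frameColoring χ ψ ρ hχ hψ hρ w e).color (.mk i j) =
      ⟨w + e * ((1 - ψ i) / (1 - ψ 1) + ψ i * ((1 - χ (j + 1)) / (1 - χ 1))), ρ⟩ := rfl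

/-- A shift moves the frame along the first edge of the polygon `Q`. -/
theorem frameColoring_shift (w e : ℂ) : (frameColoring χ ψ ρ hχ hψ hρ w e).shift =
    frameColoring χ ψ ρ hχ hψ hρ (w + e) (e * ψ 1) := by
  have h1 : 1 - χ 1 ≠ 0 := sub_ne_zero.2 hχ.symm
  have h2 : 1 - ψ 1 ≠ 0 := sub_ne_zero.2 hψ.symm
  apply TorusColoring.ext
  funext a
  obtain ⟨i, j⟩ := a
  change (frameColoring χ ψ ρ hχ hψ hρ w e).color (.mk (i + 1) j) =
    (frameColoring χ ψ ρ hχ hψ hρ _ _).color (.mk i j)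
  rw [frameColoring_color, frameColoring_color]
  ext
  · simp only [AddChar.map_add_eq_mul]
    field_simp
    ring
  · rfl

/-- A switch reverses the first edge and exchanges the roles of the two polygons. -/
theorem frameColoring_isSwitch {χ' : AddChar (ZMod q.natAbs) ℂ} {ψ' : AddChar (ZMod p.natAbs) ℂ}
    {hχ' : χ' 1 ≠ 1} {hψ' : ψ' 1 ≠ 1} {hρ' : ρ * χ' 1 = ψ' 1}
    (h₁ : ∀ j, χ' j = ψ (-j)) (h₂ : ∀ j, ψ' j = χ (-j)) (w e : ℂ) :
    (frameColoring χ ψ ρ hχ hψ hρ w e).IsSwitch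
      (frameColoring χ' ψ' ρ hχ' hψ' hρ' (w + e) (-e)) := by
  have e1 : χ' 1 * ψ 1 = 1 := by rw [h₁, ← AddChar.map_add_eq_mul]; simp
  have e2 : ψ' 1 * χ 1 = 1 := by rw [h₂, ← AddChar.map_add_eq_mul]; simp
  have k1 : 1 - χ 1 ≠ 0 := sub_ne_zero.2 hχ.symm
  have k2 : 1 - ψ 1 ≠ 0 := sub_ne_zero.2 hψ.symm
  have k3 : 1 - χ' 1 ≠ 0 := sub_ne_zero.2 hχ'.symm
  have k4 : 1 - ψ' 1 ≠ 0 := sub_ne_zero.2 hψ'.symm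
  constructor
  · intro j
    rw [frameColoring_color, frameColoring_color]
    ext
    · simp only [AddChar.map_zero_eq_one, neg_add_cancel, sub_self, zero_div, mul_zero, add_zero,
        zero_add, AddChar.map_add_eq_mul, one_mul]
      rw [← h₁ j]
      field_simp
      linear_combination (e * (1 - χ' j)) * e1
    · rfl
  · intro i
    rw [frameColoring_color, frameColoring_color]
    ext
    · simp only [AddChar.map_zero_eq_one, neg_add_cancel, sub_self, zero_div, mul_zero, add_zero,
        zero_add, AddChar.map_add_eq_mul, one_mul]
      rw [← h₂ i]
      field_simp
      linear_combination (e * (1 - ψ' i)) * e2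
    · rfl

variable {p₀ q₀ : ℤ} {C₀ : TorusColoring RotE2 p₀ q₀} {s : ℕ}

/-- Repeated shifts; taking `i = -1` gives the inverse of a shift. -/
theorem frameColoring_obtained_shift [NeZero q.natAbs] {w e : ℂ}
    (h : C₀.Obtained s (frameColoring χ ψ ρ hχ hψ hρ w e)) (i : ZMod q.natAbs) :
    C₀.Obtained s
      (frameColoring χ ψ ρ hχ hψ hρ (w + e * ((1 - ψ i) / (1 - ψ 1))) (e * ψ i)) := by
  have h2 : 1 - ψ 1 ≠ 0 := sub_ne_zero.2 hψ.symm
  rw [← ZMod.natCast_zmod_val i]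
  induction i.val with
  | zero => simpa using h
  | succ t ih =>
    have := ih.shift
    rw [frameColoring_shift] at this
    convert this using 2
    · simp only [Nat.cast_add, Nat.cast_one, AddChar.map_add_eq_mul]
      field_simp
      ring
    · simp only [Nat.cast_add, Nat.cast_one, AddChar.map_add_eq_mul]
      ring

/-- Shifts between two switches turn the frame around the other polygon. -/
theorem frameColoring_obtained_switch [NeZero p.natAbs] {w e : ℂ}
    (h : C₀.Obtained s (frameColoring χ ψ ρ hχ hψ hρ w e)) (i : ZMod p.natAbs) :
    C₀.Obtained (s + 2)
      (frameColoring χ ψ ρ hχ hψ hρ (w + e * ((1 - χ i) / (1 - χ 1))) (e * χ i)) := by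
  have k1 : 1 - χ 1 ≠ 0 := sub_ne_zero.2 hχ.symm
  have e1 : ψ⁻¹ 1 * ψ 1 = 1 := by rw [AddChar.inv_apply, ← AddChar.map_add_eq_mul]; simp
  have e2 : χ⁻¹ 1 * χ 1 = 1 := by rw [AddChar.inv_apply, ← AddChar.map_add_eq_mul]; simp
  have hχ' : ψ⁻¹ 1 ≠ 1 := fun h => hψ (by simpa [h] using e1)
  have hψ' : χ⁻¹ 1 ≠ 1 := fun h => hχ (by simpa [h] using e2)
  have hρ' : ρ * ψ⁻¹ 1 = χ⁻¹ 1 := by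
    linear_combination (-(ρ : ℂ) * ψ⁻¹ 1) * e2 + ψ⁻¹ 1 * χ⁻¹ 1 * hρ + χ⁻¹ 1 * e1
  have k4 : 1 - χ⁻¹ 1 ≠ 0 := sub_ne_zero.2 hψ'.symm
  have h₁ := h.switch (frameColoring_isSwitch (χ' := ψ⁻¹) (ψ' := χ⁻¹) (hχ' := hχ') (hψ' := hψ')
    (hρ' := hρ') (fun j => AddChar.inv_apply ψ j) (fun j => AddChar.inv_apply χ j) w e)
  have h₂ := (frameColoring_obtained_shift h₁ (-i)).switch
    (frameColoring_isSwitch (χ' := χ) (ψ' := ψ) (hχ' := hχ) (hψ' := hψ) (hρ' := hρ)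
      (fun j => by simp [AddChar.inv_apply]) (fun j => by simp [AddChar.inv_apply]) _ _)
  convert h₂ using 2
  · have : χ⁻¹ (-i) = χ i := by simp [AddChar.inv_apply]
    rw [this]
    field_simp
    linear_combination (-e * (1 - χ i)) * e2
  · simp [AddChar.inv_apply]

end Frame

/-! ### The group of frame motions -/

/-- In the quotient by `x - y` coprimality forces `x = y = 1`, and then the vanishing geometric
sums say that `m = n = 0`, so that the quotient is trivial. -/
theorem isUnit_sub_of_coprime_geom_sum {R : Type*} [CommRing R] {x y : R} {m n : ℕ}
    (hmn : Nat.Coprime m n) (hx : x ^ n = 1) (hy : y ^ m = 1)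
    (hxs : ∑ i ∈ Finset.range n, x ^ i = 0) (hys : ∑ i ∈ Finset.range m, y ^ i = 0) :
    IsUnit (x - y) := by
  rw [← Ideal.span_singleton_eq_top, ← Ideal.Quotient.subsingleton_iff]
  let f := Ideal.Quotient.mk (Ideal.span {x - y})
  have hxy : f x = f y := Ideal.Quotient.eq.2 (Ideal.mem_span_singleton_self _)
  have h1 : f x = 1 := by
    rw [← orderOf_eq_one_iff, ← Nat.dvd_one, ← hmn]
    refine Nat.dvd_gcd (orderOf_dvd_of_pow_eq_one ?_) (orderOf_dvd_of_pow_eq_one ?_)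
    · rw [hxy, ← map_pow, hy, map_one]
    · rw [← map_pow, hx, map_one]
  have hn : (n : R ⧸ Ideal.span {x - y}) = 0 := by
    have := congrArg f hxs
    simpa [map_sum, h1] using this
  have hm : (m : R ⧸ Ideal.span {x - y}) = 0 := by
    have := congrArg f hys
    simpa [map_sum, ← hxy, h1] using this
  refine subsingleton_of_zero_eq_one ?_
  have := congrArg (Int.cast : ℤ → R ⧸ Ideal.span {x - y}) (Nat.gcd_eq_gcd_ab m n)
  rw [hmn] at this
  simpa [hn, hm] using this.symm

theorem geom_sum_eq_zero_of_pow_eq_one {K : Type*} [Field K] {x : K} {n : ℕ} (hx : x ^ n = 1)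
    (h1 : x ≠ 1) : ∑ i ∈ Finset.range n, x ^ i = 0 := by
  rw [geom_sum_eq h1, hx, sub_self, zero_div]

/-- If a set of frames `(w, e)` is stable under the motions `(w, e) ↦ (w + e, e x)` for
`x = η, μ` and under their inverses, then it is stable under translation by `e g` for all
`g ∈ ℤ[η, μ]`: these `g` form an ideal, which contains the unit `η - μ` because of the commutator
of the two motions. -/
theorem translate_mem_of_stable {S : Set (ℂ × ℂ)} {η μ : ℂ} {m n : ℕ}
    (hmn : Nat.Coprime m n) (hη : η ^ n = 1) (hμ : μ ^ m = 1) (hη1 : η ≠ 1) (hμ1 : μ ≠ 1)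
    (hS : ∀ x ∈ ({η, μ} : Set ℂ), ∀ w e, (w, e) ∈ S ↔ (w + e, e * x) ∈ S)
    {g : ℂ} (hg : g ∈ Algebra.adjoin ℤ {η, μ}) {w e : ℂ} (h : (w, e) ∈ S) :
    (w + e * g, e) ∈ S := by
  set A := Algebra.adjoin ℤ ({η, μ} : Set ℂ)
  have hsub : ({η, μ} : Set ℂ) ⊆ A := Algebra.subset_adjoin
  -- the additive group of all `g` such that translation by `e g` preserves membership
  let H : AddSubgroup ℂ :=
    { carrier := {g | ∀ w e, (w, e) ∈ S ↔ (w + e * g, e) ∈ S}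
      zero_mem' := by simp
      add_mem' := by
        intro a b ha hb w e
        rw [ha, hb, mul_add, add_assoc]
      neg_mem' := by
        intro a ha w e
        rw [ha (w + e * -a)]
        simp }
  -- conjugation by a motion
  have hmulx : ∀ x ∈ ({η, μ} : Set ℂ), ∀ g ∈ H, x * g ∈ H := by
    intro x hx g hg w e
    rw [hS x hx w e, hg, hS x hx (w + e * (x * g))]
    ring_nf
  have hmul : ∀ a ∈ A, ∀ g ∈ H, a * g ∈ H := by
    intro a ha
    induction ha using Algebra.adjoin_induction with
    | mem x hx => exact hmulx x hx
    | algebraMap r => intro g hg; simpa using H.zsmul_mem hg r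
    | add x y _ _ hx hy => intro g hg; rw [add_mul]; exact H.add_mem (hx g hg) (hy g hg)
    | mul x y _ _ hx hy => intro g hg; rw [mul_assoc]; exact hx _ (hy g hg)
  -- the commutator
  have hcomm : η - μ ∈ H := by
    intro w e
    -- both orders of the two motions lead to the same frame if the second one starts from the
    -- translated frame
    rw [hS η (by simp) w e, hS μ (by simp) (w + e), hS μ (by simp) (w + e * (η - μ)),
      hS η (by simp) (w + e * (η - μ) + e)]
    ring_nf
  have hunit : IsUnit ((⟨η, hsub (by simp)⟩ : A) - ⟨μ, hsub (by simp)⟩) := by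
    apply isUnit_sub_of_coprime_geom_sum hmn
    · exact Subtype.ext hη
    · exact Subtype.ext hμ
    · exact Subtype.ext (by simpa using geom_sum_eq_zero_of_pow_eq_one hη hη1)
    · exact Subtype.ext (by simpa using geom_sum_eq_zero_of_pow_eq_one hμ hμ1)
  obtain ⟨b, hb⟩ := hunit.exists_left_inv
  have hb' : (b : ℂ) * (η - μ) = 1 := congrArg Subtype.val hb
  have : g ∈ H := by
    rw [← mul_one g, ← hb']
    exact hmul g hg _ (hmul b b.2 _ hcomm)
  exact (this w e).1 h

/-! ### Colors of all obtained colorings -/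

/-- A set of colors that is closed under the quandle operation and contains the colors of the
initial coloring contains the colors of every coloring obtained from it, since all colors of a
coloring are products of those in the row `i = 0`, which a switch takes over. -/
theorem TorusColoring.Obtained.color_mem {X : Type*} [Quandle X] {p q p₁ q₁ : ℤ}
    (hp : p ≠ 0) (hq : q ≠ 0) {C₀ : TorusColoring X p q} {s : ℕ} {C : TorusColoring X p₁ q₁}
    (h : C₀.Obtained s C) {S : Set X} (hS : ∀ x ∈ S, ∀ y ∈ S, Shelf.act x y ∈ S)
    (h₀ : ∀ a, C₀.color a ∈ S) (a : TorusArc p₁ q₁) : C.color a ∈ S := by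
  suffices p₁ ≠ 0 ∧ q₁ ≠ 0 ∧ ∀ a, C.color a ∈ S from this.2.2 a
  clear a
  induction h with
  | refl => exact ⟨hp, hq, h₀⟩
  | shift _ ih => exact ⟨ih.1, ih.2.1, fun a => ih.2.2 _⟩
  | @switch s p₁ q₁ C C' _ hC ih =>
    refine ⟨ih.2.1, ih.1, ?_⟩
    rintro ⟨i, j⟩
    change C'.color (.mk i j) ∈ S
    have : NeZero p₁.natAbs := ⟨Int.natAbs_ne_zero.2 ih.1⟩
    rw [← ZMod.natCast_zmod_val i]
    induction i.val generalizing j with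
    | zero => rw [Nat.cast_zero, hC.1]; exact ih.2.2 _
    | succ t iht =>
      rw [Nat.cast_succ]
      by_cases hj : j + 1 = 0
      · -- this arc also carries a label in the preceding row
        have : (TorusArc.mk (t + 1) j : TorusArc q₁ p₁) = .mk t 0 := by
          rw [eq_neg_of_add_eq_zero_left hj]
          exact (Quot.sound (SameArc.glue _)).symm
        rw [this]
        exact iht 0
      · have := C'.crossing t (j + 1) hj
        rw [add_sub_cancel_right] at this
        rw [this]
        exact hS _ (iht 0) _ (iht _)

/-! ### The ring generated by the unit vectors -/

theorem unitVector_eq (α : ℕ) {e : ℂ} (he : ‖e‖ = 1) (σ : ℕ) :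
    unitVector α e σ = e * exp (2 * Real.pi * I / (2 * α : ℕ)) ^ σ := by
  have h1 : e = exp (e.arg * I) := by
    have := norm_mul_exp_arg_mul_I e
    rw [he] at this
    simpa using this.symm
  conv_rhs => rw [h1]
  rw [← exp_nat_mul, ← exp_add, unitVector, ofReal_cos, ofReal_sin, ← exp_mul_I]
  congr 1
  push_cast
  rcases eq_or_ne (α : ℂ) 0 with h | h
  · simp [h]
  · field_simp

theorem orderOf_exp_mul_div {n : ℕ} (hn : n ≠ 0) (l : ℕ) :
    orderOf (exp (2 * Real.pi * I * l / n)) = n / n.gcd l := by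
  have h := isPrimitiveRoot_exp n hn
  have h2 : exp (2 * Real.pi * I * l / n) = exp (2 * Real.pi * I / n) ^ l := by
    rw [← exp_nat_mul]
    congr 1
    ring
  have hfin : IsOfFinOrder (exp (2 * Real.pi * I / n)) :=
    isOfFinOrder_iff_pow_eq_one.2 ⟨n, Nat.pos_of_ne_zero hn, h.pow_eq_one⟩
  rw [h2, hfin.orderOf_pow, ← h.eq_orderOf]

/-- For roots of unity `η` and `μ` of coprime orders, a primitive root of unity of order
`lcm (2, orderOf η * orderOf μ)` generates the same ring as `η` and `μ`. -/
theorem adjoin_pair_eq_adjoin_singleton {η μ ζ : ℂ} {α : ℕ} (hα : α ≠ 0)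
    (hζ : IsPrimitiveRoot ζ (2 * α)) (hη : orderOf η ≠ 0) (hμ : orderOf μ ≠ 0)
    (hco : Nat.Coprime (orderOf η) (orderOf μ))
    (h : if Even (orderOf μ * orderOf η) then 2 * α = orderOf μ * orderOf η
      else α = orderOf μ * orderOf η) :
    Algebra.adjoin ℤ {η, μ} = Algebra.adjoin ℤ {ζ} := by
  have hdvd : orderOf μ * orderOf η ∣ 2 * α := by
    split_ifs at h
    · rw [h]
    · rw [← h]; exact dvd_mul_left _ _
  have : NeZero (2 * α) := ⟨by omega⟩
  have hord : orderOf (μ * η) = orderOf μ * orderOf η :=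
    (Commute.all μ η).orderOf_mul_eq_mul_orderOf_of_coprime hco.symm
  have hN : NeZero (orderOf μ * orderOf η) := ⟨mul_ne_zero hμ hη⟩
  have hprim : IsPrimitiveRoot (μ * η) (orderOf μ * orderOf η) := hord ▸ IsPrimitiveRoot.orderOf _
  apply le_antisymm
  · rw [Algebra.adjoin_le_iff]
    intro x hx
    have hx' : x ^ (2 * α) = 1 := by
      rw [← orderOf_dvd_iff_pow_eq_one]
      rcases hx with rfl | rfl
      · exact (dvd_mul_left _ _).trans hdvd
      · exact (dvd_mul_right _ _).trans hdvd
    obtain ⟨i, -, rfl⟩ := hζ.eq_pow_of_pow_eq_one hx'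
    exact pow_mem (Algebra.self_mem_adjoin_singleton ℤ ζ) i
  · rw [Algebra.adjoin_le_iff, Set.singleton_subset_iff]
    have hmem : μ * η ∈ Algebra.adjoin ℤ {η, μ} :=
      mul_mem (Algebra.subset_adjoin (by simp)) (Algebra.subset_adjoin (by simp))
    have key : ∀ x : ℂ, x ^ (orderOf μ * orderOf η) = 1 → x ∈ Algebra.adjoin ℤ {η, μ} := by
      intro x hx
      obtain ⟨i, -, rfl⟩ := hprim.eq_pow_of_pow_eq_one hx
      exact pow_mem hmem i
    split_ifs at h with hev
    · exact key ζ (h ▸ hζ.pow_eq_one)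
    · -- `N = orderOf μ * orderOf η` is odd, `ζ ^ N = ± 1`, and so `ζ` or `-ζ` is a power of `μ η`
      have h2 := hζ.pow_eq_one
      rw [h, mul_comm 2, pow_mul, sq_eq_one_iff] at h2
      rcases h2 with h2 | h2
      · exact key ζ h2
      · have h3 : (-ζ) ^ (orderOf μ * orderOf η) = 1 := by
          rw [(Nat.not_even_iff_odd.1 hev).neg_pow, h2, neg_neg]
        exact neg_mem_iff.1 (key _ h3)

/-- All sums of the vectors `v_σ` with integral coefficients are sums with non-negative
coefficients, because `-v_σ = v_{σ + α}`. -/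
theorem generatedSet_of_mem_adjoin {α : ℕ} (hα : α ≠ 0) {w₀ e : ℂ} (he : ‖e‖ = 1) {g : ℂ}
    (hg : g ∈ Algebra.adjoin ℤ {exp (2 * Real.pi * I / (2 * α : ℕ))}) :
    w₀ + e * g ∈ GeneratedSet α w₀ e := by
  set ζ := exp (2 * Real.pi * I / (2 * α : ℕ)) with hζdef
  have hζ : IsPrimitiveRoot ζ (2 * α) := isPrimitiveRoot_exp _ (by omega)
  have hζα : ζ ^ α = -1 := by
    have := hζ.pow_of_dvd hα (dvd_mul_left α 2)
    rw [Nat.mul_div_cancel _ (Nat.pos_of_ne_zero hα)] at this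
    exact this.eq_neg_one_of_two_right
  have step : ∀ (t : ℕ) x, x ∈ GeneratedSet α w₀ e → x + e * ζ ^ t ∈ GeneratedSet α w₀ e := by
    intro t x hx
    rw [pow_eq_pow_mod t hζ.pow_eq_one, ← unitVector_eq α he]
    exact GeneratedSet.step x _ hx (Nat.mod_lt _ (by omega))
  suffices ∀ x, (x ∈ GeneratedSet α w₀ e → x + e * g ∈ GeneratedSet α w₀ e) ∧
      (x ∈ GeneratedSet α w₀ e → x - e * g ∈ GeneratedSet α w₀ e) from (this w₀).1 GeneratedSet.base
  rw [Algebra.adjoin_singleton_eq_range_aeval] at hg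
  obtain ⟨f, rfl⟩ := hg
  induction f using Polynomial.induction_on' with
  | add f g hf hg =>
    intro x
    simp only [map_add, mul_add, ← add_assoc, ← sub_sub]
    exact ⟨fun h => (hg _).1 ((hf _).1 h), fun h => (hg _).2 ((hf _).2 h)⟩
  | monomial t a =>
    have hpos : ∀ (b : ℕ) (t : ℕ) x, x ∈ GeneratedSet α w₀ e →
        x + e * (b * ζ ^ t) ∈ GeneratedSet α w₀ e := by
      intro b t x hx
      induction b with
      | zero => simpa using hx
      | succ b ih =>
        convert step t _ ih using 1
        push_cast
        ring
    intro x
    obtain ⟨b, rfl | rfl⟩ := a.eq_nat_or_neg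
    · refine ⟨fun h => ?_, fun h => ?_⟩
      · simpa [Polynomial.aeval_monomial] using hpos b t x h
      · simpa [Polynomial.aeval_monomial, pow_add, hζα, sub_eq_add_neg] using hpos b (t + α) x h
    · refine ⟨fun h => ?_, fun h => ?_⟩
      · simpa [Polynomial.aeval_monomial, pow_add, hζα, sub_eq_add_neg] using hpos b (t + α) x h
      · simpa [Polynomial.aeval_monomial] using hpos b t x h

theorem GeneratedSet.exists_sum {α : ℕ} {w₀ e z : ℂ} (h : z ∈ GeneratedSet α w₀ e) :
    ∃ a : ℕ → ℤ, z = w₀ + ∑ σ ∈ Finset.range (2 * α), (a σ : ℂ) * unitVector α e σ := by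
  induction h with
  | base => exact ⟨0, by simp⟩
  | step x σ _ hσ ih =>
    obtain ⟨a, rfl⟩ := ih
    refine ⟨a + Pi.single σ 1, ?_⟩
    simp [add_mul, Finset.sum_add_distrib, Pi.single_apply, hσ, add_assoc]

theorem exists_mem_adjoin_of_sum {α : ℕ} {e : ℂ} (he : ‖e‖ = 1) (a : ℕ → ℤ) :
    ∃ g ∈ Algebra.adjoin ℤ {exp (2 * Real.pi * I / (2 * α : ℕ))},
      ∑ σ ∈ Finset.range (2 * α), (a σ : ℂ) * unitVector α e σ = e * g := by
  refine ⟨∑ σ ∈ Finset.range (2 * α), a σ * exp (2 * Real.pi * I / (2 * α : ℕ)) ^ σ,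
    sum_mem fun σ _ => mul_mem (intCast_mem _ _)
      (pow_mem (Algebra.self_mem_adjoin_singleton ℤ _) σ), ?_⟩
  rw [Finset.mul_sum]
  refine Finset.sum_congr rfl fun σ _ => ?_
  rw [unitVector_eq α he]
  ring

/-! ### The coloring of a trochoid -/

/-- The number `[j]_x` attached to an additive character with `x = χ 1` is a geometric sum. -/
theorem one_sub_div_mem_adjoin {n : ℕ} [NeZero n] (χ : AddChar (ZMod n) ℂ) (hχ : χ 1 ≠ 1)
    {A : Subalgebra ℤ ℂ} (h : χ 1 ∈ A) (j : ZMod n) :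
    χ j ∈ A ∧ (1 - χ j) / (1 - χ 1) ∈ A := by
  have hj : χ j = χ 1 ^ j.val := by
    rw [← AddChar.map_nsmul_eq_pow, nsmul_one, ZMod.natCast_zmod_val]
  rw [hj, ← neg_div_neg_eq, neg_sub, neg_sub, ← geom_sum_eq hχ]
  exact ⟨pow_mem h _, sum_mem fun i _ => pow_mem h i⟩

theorem eq_center_add_addChar_mul {m : ℕ} [NeZero m] {v : ZMod m → ℂ} {c : ℂ}
    (χ : AddChar (ZMod m) ℂ) (h : ∀ i, v (i + 1) - c = χ 1 * (v i - c)) (i : ZMod m) :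
    v i = c + χ i * (v 0 - c) := by
  rw [← ZMod.natCast_zmod_val i]
  induction i.val with
  | zero => simp
  | succ t ih =>
    have := h t
    rw [Nat.cast_succ, AddChar.map_add_eq_mul]
    linear_combination this + χ 1 * ih

/-- The coloring derived from a trochoid is the one attached to the frame given by its first
edge. -/
theorem Trochoid.coloring_eq_frameColoring {p q : ℤ} {k l : ℕ}
    (T : Trochoid p.natAbs k q.natAbs l)
    {χ : AddChar (ZMod p.natAbs) ℂ} {ψ : AddChar (ZMod q.natAbs) ℂ}
    (hχ₁ : χ 1 = exp (2 * Real.pi * I * k / p.natAbs))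
    (hψ₁ : ψ 1 = exp (2 * Real.pi * I * l / q.natAbs))
    (hχ : χ 1 ≠ 1) (hψ : ψ 1 ≠ 1) (hρ : Circle.exp T.angle * χ 1 = ψ 1) :
    T.coloring = frameColoring χ ψ (Circle.exp T.angle) hχ hψ hρ (T.P₀ 0) (T.P₀ 1 - T.P₀ 0) := by
  have : NeZero p.natAbs := ⟨by have := T.two_le_m; omega⟩
  have : NeZero q.natAbs := ⟨by have := T.two_le_n; omega⟩
  have h1 : 1 - χ 1 ≠ 0 := sub_ne_zero.2 hχ.symm
  have h2 : 1 - ψ 1 ≠ 0 := sub_ne_zero.2 hψ.symm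
  obtain ⟨cP, hP⟩ := T.regular_P₀.exists_center T.two_le_m
  obtain ⟨cQ, hQ⟩ := T.regular_Q.exists_center T.two_le_n
  rw [← hχ₁] at hP
  rw [← hψ₁] at hQ
  apply TorusColoring.ext
  funext a
  obtain ⟨i, j⟩ := a
  change (⟨T.w i.val (i.val + j + 1), Circle.exp T.angle⟩ : RotE2) =
    (frameColoring χ ψ _ hχ hψ hρ _ _).color (.mk i j)
  rw [frameColoring_color]
  ext
  · have hψi : exp (2 * Real.pi * I * l / q.natAbs) ^ i.val = ψ i := by
      rw [← hψ₁, ← AddChar.map_nsmul_eq_pow, nsmul_one, ZMod.natCast_zmod_val]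
    have e1 := eq_center_add_addChar_mul χ hP (j + 1)
    have e2 := eq_center_add_addChar_mul χ hP 1
    have e3 := eq_center_add_addChar_mul ψ hQ i
    have e4 := eq_center_add_addChar_mul ψ hQ 1
    have e5 := T.vertex_zero
    have e6 := T.vertex_one
    simp only
    rw [add_assoc, T.w_val, hψi, e3]
    have e7 : (T.P₀ 1 - T.P₀ 0) / (1 - χ 1) = cP - T.P₀ 0 := by
      rw [div_eq_iff h1]; linear_combination e2
    have e8 : (T.P₀ 1 - T.P₀ 0) / (1 - ψ 1) = cQ - T.Q 0 := by
      rw [div_eq_iff h2]; linear_combination e4 + e6 - e5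
    linear_combination ψ i * e1 - (1 - ψ i) * e8 - ψ i * (1 - χ (j + 1)) * e7 - e5
  · rfl

/-! ### The reached points -/

theorem proposition6p1 (p q : ℤ) (hp : 2 ≤ |p|) (hq : 2 ≤ |q|) (hpq : IsCoprime p q)
    (k l : ℕ) (T : Trochoid p.natAbs k q.natAbs l) (hside : ‖T.Q 1 - T.Q 0‖ = 1) :
    let α := trochoidAlpha p q k l
    let w₀₀ := T.P₀ 0
    let w₀₁ := T.P₀ 1
    GeneratedSet α w₀₀ (w₀₁ - w₀₀) = T.coloring.reachedPoints ∧
      T.coloring.reachedPoints =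
        {z | ∃ a : ℕ → ℤ, z = w₀₀ +
          ∑ σ ∈ Finset.range (2 * α), (a σ : ℂ) * unitVector α (w₀₁ - w₀₀) σ} := by
  intro α w₀₀ w₀₁
  have hp0 : p.natAbs ≠ 0 := by rw [Int.abs_eq_natAbs] at hp; omega
  have hq0 : q.natAbs ≠ 0 := by rw [Int.abs_eq_natAbs] at hq; omega
  have : NeZero p.natAbs := ⟨hp0⟩
  have : NeZero q.natAbs := ⟨hq0⟩
  have hco : Nat.Coprime p.natAbs q.natAbs := Int.isCoprime_iff_gcd_eq_one.1 hpq
  set μ := exp (2 * Real.pi * I * k / p.natAbs) with hμdef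
  set η := exp (2 * Real.pi * I * l / q.natAbs) with hηdef
  have hordμ : orderOf μ = p.natAbs / p.natAbs.gcd k := orderOf_exp_mul_div hp0 k
  have hordη : orderOf η = q.natAbs / q.natAbs.gcd l := orderOf_exp_mul_div hq0 l
  have hdμ : orderOf μ ∣ p.natAbs := hordμ ▸ Nat.div_dvd_of_dvd (Nat.gcd_dvd_left _ _)
  have hdη : orderOf η ∣ q.natAbs := hordη ▸ Nat.div_dvd_of_dvd (Nat.gcd_dvd_left _ _)
  have hμ : μ ^ p.natAbs = 1 := orderOf_dvd_iff_pow_eq_one.1 hdμ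
  have hη : η ^ q.natAbs = 1 := orderOf_dvd_iff_pow_eq_one.1 hdη
  have hμ0 : orderOf μ ≠ 0 := fun h => hp0 (by simpa [h] using hdμ)
  have hη0 : orderOf η ≠ 0 := fun h => hq0 (by simpa [h] using hdη)
  -- `0 < k < |p|` and `0 < l < |q|` exclude degenerate polygons
  have ne_one : ∀ {n t : ℕ} {x : ℂ}, orderOf x = n / n.gcd t → 1 ≤ t → t < n → x ≠ 1 := by
    intro n t x h ht htn hx
    rw [hx, orderOf_one] at h
    have h1 := Nat.div_mul_cancel (Nat.gcd_dvd_left n t)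
    have h2 := Nat.gcd_le_right n (show 0 < t by omega)
    rw [← h] at h1
    omega
  have hμ1 : μ ≠ 1 := ne_one hordμ T.one_le_k T.k_lt
  have hη1 : η ≠ 1 := ne_one hordη T.one_le_l T.l_lt
  -- the coloring of the trochoid as the coloring of a frame
  set χ : AddChar (ZMod p.natAbs) ℂ := AddChar.zmodChar _ hμ
  set ψ : AddChar (ZMod q.natAbs) ℂ := AddChar.zmodChar _ hη
  have hχ₁ : χ 1 = μ := by simpa using AddChar.zmodChar_apply' hμ 1
  have hψ₁ : ψ 1 = η := by simpa using AddChar.zmodChar_apply' hη 1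
  have hχ : χ 1 ≠ 1 := hχ₁ ▸ hμ1
  have hψ : ψ 1 ≠ 1 := hψ₁ ▸ hη1
  set ρ := Circle.exp T.angle
  have hρμ : ρ * μ = η := by
    have hpC : (p.natAbs : ℂ) ≠ 0 := by exact_mod_cast hp0
    have hqC : (q.natAbs : ℂ) ≠ 0 := by exact_mod_cast hq0
    rw [Circle.coe_exp, hμdef, hηdef, ← exp_add]
    congr 1
    simp only [Trochoid.angle]
    push_cast
    field_simp
    ring
  have hρ : ρ * χ 1 = ψ 1 := by rw [hχ₁, hψ₁, hρμ]
  have hC := T.coloring_eq_frameColoring hχ₁ hψ₁ hχ hψ hρ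
  have hnorm : ‖w₀₁ - w₀₀‖ = 1 := by
    rw [← hside, ← T.vertex_zero, ← T.vertex_one]
  -- the ring `ℤ[η, μ]`
  have hα : α ≠ 0 ∧ if Even (orderOf μ * orderOf η) then 2 * α = orderOf μ * orderOf η
      else α = orderOf μ * orderOf η := by
    have hpos : orderOf μ * orderOf η ≠ 0 := mul_ne_zero hμ0 hη0
    simp only [α, trochoidAlpha, ← hordμ, ← hordη]
    split_ifs with h
    · obtain ⟨t, ht⟩ := h
      omega
    · exact ⟨hpos, rfl⟩
  have hA := adjoin_pair_eq_adjoin_singleton hα.1 (isPrimitiveRoot_exp (2 * α) (by omega)) hη0 hμ0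
    (hco.symm.of_dvd hdη hdμ) hα.2
  set A := Algebra.adjoin ℤ ({η, μ} : Set ℂ) with hAdef
  have hηA : η ∈ A := Algebra.subset_adjoin (by simp)
  have hμA : μ ∈ A := Algebra.subset_adjoin (by simp)
  have hρA : (ρ : ℂ) ∈ A := by
    have : (ρ : ℂ) = η * μ ^ (p.natAbs - 1) := by
      rw [← hρμ, mul_assoc, ← pow_succ', Nat.sub_add_cancel (by omega), hμ, mul_one]
    rw [this]
    exact mul_mem hηA (pow_mem hμA _)
  have h₁ : GeneratedSet α w₀₀ (w₀₁ - w₀₀) ⊆ {z | ∃ a : ℕ → ℤ, z = w₀₀ +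
      ∑ σ ∈ Finset.range (2 * α), (a σ : ℂ) * unitVector α (w₀₁ - w₀₀) σ} :=
    fun z hz => GeneratedSet.exists_sum hz
  have h₂ : {z | ∃ a : ℕ → ℤ, z = w₀₀ +
      ∑ σ ∈ Finset.range (2 * α), (a σ : ℂ) * unitVector α (w₀₁ - w₀₀) σ} ⊆
        T.coloring.reachedPoints := by
    rintro _ ⟨a, rfl⟩
    obtain ⟨g, hg, hsum⟩ := exists_mem_adjoin_of_sum (α := α) hnorm a
    rw [← hA] at hg
    rw [hsum]
    let F : Set (ℂ × ℂ) := {x | ∃ s, Even s ∧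
      T.coloring.Obtained s (frameColoring χ ψ ρ hχ hψ hρ x.1 x.2)}
    have hF₀ : (w₀₀, w₀₁ - w₀₀) ∈ F := ⟨0, Even.zero, by rw [← hC]; exact .refl⟩
    have h1χ : 1 - χ 1 ≠ 0 := sub_ne_zero.2 hχ.symm
    have h1ψ : 1 - ψ 1 ≠ 0 := sub_ne_zero.2 hψ.symm
    have hχn : χ 1 * χ (-1) = 1 := by rw [← AddChar.map_add_eq_mul]; simp
    have hψn : ψ 1 * ψ (-1) = 1 := by rw [← AddChar.map_add_eq_mul]; simp
    have hF : ∀ x ∈ ({η, μ} : Set ℂ), ∀ w e, (w, e) ∈ F ↔ (w + e, e * x) ∈ F := by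
      intro x hx w e
      rcases hx with rfl | rfl
      · rw [← hψ₁]
        refine ⟨fun ⟨s, hs, h⟩ => ⟨s, hs, ?_⟩, fun ⟨s, hs, h⟩ => ⟨s, hs, ?_⟩⟩
        · simpa [div_self h1ψ] using frameColoring_obtained_shift h 1
        · convert frameColoring_obtained_shift h (-1) using 2
          · simp only
            field_simp
            linear_combination e * hψn
          · simp only [mul_assoc, hψn, mul_one]
      · rw [← hχ₁]
        refine ⟨fun ⟨s, hs, h⟩ => ⟨s + 2, hs.add even_two, ?_⟩,
          fun ⟨s, hs, h⟩ => ⟨s + 2, hs.add even_two, ?_⟩⟩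
        · simpa [div_self h1χ] using frameColoring_obtained_switch h 1
        · convert frameColoring_obtained_switch h (-1) using 2
          · simp only
            field_simp
            linear_combination e * hχn
          · simp only [mul_assoc, hχn, mul_one]
    obtain ⟨s, hs, h⟩ := translate_mem_of_stable hco hη hμ hη1 hμ1 hF hg hF₀
    refine ⟨s, _, .mk 0 (-1), hs, h, ?_⟩
    rw [frameColoring_color]
    simp
  have h₃ : T.coloring.reachedPoints ⊆ GeneratedSet α w₀₀ (w₀₁ - w₀₀) := by
    rintro _ ⟨s, C, a, -, h, rfl⟩
    let S : Set RotE2 := {x | x.rot = ρ ∧ ∃ g ∈ A, x.center = w₀₀ + (w₀₁ - w₀₀) * g}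
    have hS : ∀ x ∈ S, ∀ y ∈ S, Shelf.act x y ∈ S := by
      rintro x ⟨hx, g, hg, hxg⟩ y ⟨hy, f, hf, hyf⟩
      refine ⟨hy, (f - g) * ρ + g, add_mem (mul_mem (sub_mem hf hg) hρA) hg, ?_⟩
      change (y.center - x.center) * (x.rot : ℂ) + x.center = _
      rw [hx, hxg, hyf]
      ring
    have hS₀ : ∀ a, T.coloring.color a ∈ S := by
      rintro ⟨i, j⟩
      have hi := one_sub_div_mem_adjoin ψ hψ (hψ₁ ▸ hηA) i
      have hj := one_sub_div_mem_adjoin χ hχ (hχ₁ ▸ hμA) (j + 1)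
      rw [hC]
      exact ⟨rfl, _, add_mem hi.2 (mul_mem hi.1 hj.2), rfl⟩
    obtain ⟨-, g, hg, hz⟩ := h.color_mem (by simpa using hp0) (by simpa using hq0) hS hS₀ a
    rw [hz]
    exact generatedSet_of_mem_adjoin hα.1 hnorm (hA ▸ hg)
  exact ⟨(h₁.trans h₂).antisymm h₃, (h₃.trans h₁).antisymm h₂⟩
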